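/- Theorem 2.1 (Shallow terminals). All graphs are finite, simple and undirected. A graph is an interval graph if its vertices can be assigned to intervals of the real line so that two distinct vertices are adjacent if and only if their intervals intersect. A set $X$ of vertices of a graph $G$ is a minimal forbidden set if $G[X]$ is not an interval graph but $G[Y]$ is one for every proper subset $Y \subset X$. A module of $G$ is a set $M \subseteq V(G)$ all of whose vertices have the same neighbors outside $M$; it is nontrivial if $1 < |M| < |V(G)|$. The graph $G$ is reduced if it has no minimal forbidden set of at most $10$ vertices and every nontrivial module of $G$ induces a clique. For $d \ge 3$, a $\dag$-asteroidal witness is a graph with the $d+4$ vertices $s, c, b_0, b_1, \dots, b_{d+1}$ whose edges are $sc$, $cb_i$ for $1 \le i \le d$, and $b_ib_{i+1}$ for $0 \le i \le d$. For $d \ge 2$, a $\ddag$-asteroidal witness is a graph with the $d+5$ vertices $s, c_1, c_2, b_0, b_1, \dots, b_{d+1}$ whose edges are $sc_1$, $sc_2$, $c_1c_2$, $c_1b_i$ for $0 \le i \le d$, $c_2b_i$ for $1 \le i \le d+1$, and $b_ib_{i+1}$ for $0 \le i \le d$. An asteroidal triple of a graph consists of three distinct vertices each pair of which is connected by a path that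 contains no neighbor of the third. Let $W$ be a set of vertices of $G$ such that $G[W]$ is (isomorphic to) a $\dag$- or $\ddag$-asteroidal witness. A terminal of $W$ is a member of an asteroidal triple of $G[W]$, and a shallow terminal of $W$ is a terminal $x$ of $W$ such that $W \setminus N[x]$ induces a path. Then, in every reduced graph $G$, every shallow terminal $s$ of every $\dag$- or $\ddag$-asteroidal witness $W$ in $G$ is simplicial, that is, its neighborhood $N(s)$ induces a clique. -/

import Mathlib

namespace IntervalDeletion

variable {V : Type*}

/-- `G` is an interval graph: its vertices can be assigned to nonempty closed intervals
`[a v, b v]` of the real line such that two distinct vertices are adjacent if and only if their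
intervals intersect. -/
def IsIntervalGraph (G : SimpleGraph V) : Prop :=
  ∃ a b : V → ℝ, (∀ v, a v ≤ b v) ∧
    ∀ u v, u ≠ v → (G.Adj u v ↔ (Set.Icc (a u) (b u) ∩ Set.Icc (a v) (b v)).Nonempty)

/-- `X` is a minimal forbidden set: `X` does not induce an interval graph, but every proper
subset of `X` does. -/
def IsMinimalForbiddenSet (G : SimpleGraph V) (X : Set V) : Prop :=
  ¬ IsIntervalGraph (G.induce X) ∧ ∀ Y : Set V, Y ⊂ X → IsIntervalGraph (G.induce Y)

/-- `G` is prereduced: it has no minimal forbidden set of at most 10 vertices. -/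
def IsPrereduced (G : SimpleGraph V) : Prop :=
  ∀ X : Set V, IsMinimalForbiddenSet G X → ¬ X.encard ≤ 10

/-- `M` is a module: all vertices of `M` have the same neighbors outside `M`. -/
def IsModule (G : SimpleGraph V) (M : Set V) : Prop :=
  ∀ u ∈ M, ∀ v ∈ M, ∀ x, x ∉ M → (G.Adj u x ↔ G.Adj v x)

/-- `M` is a nontrivial module: a module with more than one vertex that is not the whole vertex
set. -/
def IsNontrivialModule (G : SimpleGraph V) (M : Set V) : Prop :=
  IsModule G M ∧ M.Nontrivial ∧ M ≠ Set.univ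

/-- `G` is reduced: it is prereduced and every nontrivial module induces a clique. -/
def IsReduced (G : SimpleGraph V) : Prop :=
  IsPrereduced G ∧ ∀ M : Set V, IsNontrivialModule G M → G.IsClique M

/-- `v` is simplicial: its neighbors induce a clique. -/
def IsSimplicial (G : SimpleGraph V) (v : V) : Prop :=
  G.IsClique (G.neighborSet v)

/-- `x` and `y` are connected by a path that avoids the neighborhood of `z`. -/
def ConnectedAvoiding (G : SimpleGraph V) (x y z : V) : Prop :=
  ∃ p : G.Walk x y, p.IsPath ∧ ∀ v ∈ p.support, ¬ G.Adj z v

/-- `x, y, z` form an asteroidal triple: three vertices such that each pair of them is connected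
by a path that avoids the neighborhood of the third one. -/
def IsAsteroidalTriple (G : SimpleGraph V) (x y z : V) : Prop :=
  (x ≠ y ∧ y ≠ z ∧ x ≠ z) ∧
    ConnectedAvoiding G x y z ∧ ConnectedAvoiding G y z x ∧ ConnectedAvoiding G x z y

/-- The vertices of the †-asteroidal witness with base `b 1, …, b d`; the vertices `b 0` and
`b (d + 1)` are the base terminals (also called `l` and `r`). -/
inductive DaggerVertex (d : ℕ) : Type
  | s : DaggerVertex d
  | c : DaggerVertex d
  | b (i : Fin (d + 2)) : DaggerVertex d

/-- The edges of the †-asteroidal witness, each listed in one direction: `b 0, …, b (d + 1)` is a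
path, `c` is adjacent to `s` and to each of `b 1, …, b d`. -/
def DaggerRel (d : ℕ) : DaggerVertex d → DaggerVertex d → Prop
  | .s, .c => True
  | .c, .b i => 1 ≤ i.val ∧ i.val ≤ d
  | .b i, .b j => i.val + 1 = j.val
  | _, _ => False

/-- The †-asteroidal witness with `d` base vertices, as an abstract graph. -/
def daggerGraph (d : ℕ) : SimpleGraph (DaggerVertex d) :=
  SimpleGraph.fromRel (DaggerRel d)

/-- The vertices of the ‡-asteroidal witness with base `b 1, …, b d`; the vertices `b 0` and
`b (d + 1)` are the base terminals (also called `l` and `r`). -/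
inductive DDaggerVertex (d : ℕ) : Type
  | s : DDaggerVertex d
  | c₁ : DDaggerVertex d
  | c₂ : DDaggerVertex d
  | b (i : Fin (d + 2)) : DDaggerVertex d

/-- The edges of the ‡-asteroidal witness, each listed in one direction: `b 0, …, b (d + 1)` is a
path, `s, c₁, c₂` is a triangle, `c₁` is adjacent to `b 0, …, b d`, and `c₂` is adjacent to
`b 1, …, b (d + 1)`. -/
def DDaggerRel (d : ℕ) : DDaggerVertex d → DDaggerVertex d → Prop
  | .s, .c₁ => True
  | .s, .c₂ => True
  | .c₁, .c₂ => True
  | .c₁, .b i => i.val ≤ d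
  | .c₂, .b i => 1 ≤ i.val
  | .b i, .b j => i.val + 1 = j.val
  | _, _ => False

/-- The ‡-asteroidal witness with `d` base vertices, as an abstract graph. -/
def ddaggerGraph (d : ℕ) : SimpleGraph (DDaggerVertex d) :=
  SimpleGraph.fromRel (DDaggerRel d)

/-- The vertex set `W` induces a †-asteroidal witness in `G`. -/
def IsDaggerAW (G : SimpleGraph V) (W : Set V) : Prop :=
  ∃ d : ℕ, 3 ≤ d ∧ Nonempty (G.induce W ≃g daggerGraph d)

/-- The vertex set `W` induces a ‡-asteroidal witness in `G`. -/
def IsDDaggerAW (G : SimpleGraph V) (W : Set V) : Prop :=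
  ∃ d : ℕ, 2 ≤ d ∧ Nonempty (G.induce W ≃g ddaggerGraph d)

/-- `x` is a terminal of `W`: a member of an asteroidal triple of the subgraph induced by `W`. -/
def IsTerminal (G : SimpleGraph V) (W : Set V) (x : V) : Prop :=
  ∃ (hx : x ∈ W) (y z : W), IsAsteroidalTriple (G.induce W) ⟨x, hx⟩ y z

/-- The vertex set `X` induces a path (with at least one vertex). -/
def InducesPath (G : SimpleGraph V) (X : Set V) : Prop :=
  ∃ n : ℕ, Nonempty (G.induce X ≃g SimpleGraph.pathGraph (n + 1))

/-- `x` is a shallow terminal of the †- or ‡-asteroidal witness `W`: a terminal of `W` such that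
`W - N[x]` is an induced path. -/
def IsShallowTerminalOf (G : SimpleGraph V) (W : Set V) (x : V) : Prop :=
  (IsDaggerAW G W ∨ IsDDaggerAW G W) ∧ IsTerminal G W x ∧
    InducesPath G (W \ (insert x (G.neighborSet x)))

end IntervalDeletion

namespace IntervalDeletion

variable {V : Type*}

/-! ### Small subgraphs of prereduced graphs -/

/-! In a prereduced graph every set of at most ten vertices has an interval model, so small holes
and asteroidal triples with few connecting vertices cannot occur (`not_hole`, `not_asteroidal`). All
local adjacency facts come from exhibiting such an obstruction.

A shallow terminal can only be the vertex `s` of its witness, and both kinds of witness are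
instances of `Config`. Among all configurations with foot `s`, take one with the shortest base. Let
`A` be the set of neighbors of `s` that have a neighbor on the path. A member of `A` not complete to
the base would yield a shorter configuration (`neighbor_cases`), so `A` is complete to the base, and
it is a clique because two nonadjacent members would close a 4-hole with two base vertices.

Let `M` be the set of vertices reachable from `s` without entering `A`. Every member of `M` is again
a foot of the same configuration, and adjacent feet see the same vertices that touch the path
(`of_adj`, `adj_of_adj_of_adj`). Hence `A` is complete to `M` and contains every outside neighbor of
`M`, so `M` is a module, and it is a clique since the graph is reduced. The neighborhood of `s` lies
in the clique `A ∪ M`. -/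

theorem IsPrereduced.isIntervalGraph_induce {G : SimpleGraph V} (hG : IsPrereduced G)
    (F : Finset V) : F.card ≤ 10 → IsIntervalGraph (G.induce (F : Set V)) := by
  induction F using Finset.strongInduction with
  | H F ih =>
    intro hF
    by_contra hn
    -- By induction all proper subsets induce interval graphs, so a bad `F` would itself be a
    -- minimal forbidden set.
    refine hG F ⟨hn, fun Y hY => ?_⟩ ?_
    · obtain ⟨F', rfl⟩ := (F.finite_toSet.subset hY.subset).exists_finset_coe
      have hss : F' ⊂ F := by exact_mod_cast hY
      exact ih F' hss ((Finset.card_lt_card hss).le.trans hF)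
    · rw [Set.encard_coe_eq_coe_finsetCard]
      exact_mod_cast hF

/-- An interval model of the subgraph induced by the members of a short list. -/
theorem IsPrereduced.exists_model {G : SimpleGraph V} (hG : IsPrereduced G) (L : List V)
    (hL : L.length ≤ 10) :
    ∃ a b : V → ℝ, (∀ v, a v ≤ b v) ∧
      ∀ u ∈ L, ∀ v ∈ L, u ≠ v → (G.Adj u v ↔ a u ≤ b v ∧ a v ≤ b u) := by
  classical
  obtain ⟨a, b, hab, h⟩ := hG.isIntervalGraph_induce L.toFinset (L.toFinset_card_le.trans hL)
  -- Vertices outside `L` get the dummy interval `[0, 0]`; this makes the endpoint functions total.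
  refine ⟨fun v => if hv : v ∈ (L.toFinset : Set V) then a ⟨v, hv⟩ else 0,
    fun v => if hv : v ∈ (L.toFinset : Set V) then b ⟨v, hv⟩ else 0, fun v => ?_,
    fun u hu v hv huv => ?_⟩
  · by_cases hv : v ∈ (L.toFinset : Set V)
    · simpa only [dif_pos hv] using hab ⟨v, hv⟩
    · simp only [dif_neg hv, le_refl]
  · have hu' : u ∈ (L.toFinset : Set V) := by simpa using hu
    have hv' : v ∈ (L.toFinset : Set V) := by simpa using hv
    have := h ⟨u, hu'⟩ ⟨v, hv'⟩ (by simpa using huv)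
    simp only [dif_pos hu', dif_pos hv']
    rw [SimpleGraph.comap_adj] at this
    rw [show G.Adj u v ↔ _ from this, Set.Icc_inter_Icc, Set.nonempty_Icc, sup_le_iff,
      le_inf_iff, le_inf_iff]
    have h1 := hab ⟨u, hu'⟩
    have h2 := hab ⟨v, hv'⟩
    tauto

/-- In an interval model, a walk without closed neighbors of `m` stays on one side of `m`. -/
theorem forall_left_or_forall_right {G : SimpleGraph V} {L : List V} {a b : V → ℝ}
    (hab : ∀ v, a v ≤ b v)
    (h : ∀ u ∈ L, ∀ v ∈ L, u ≠ v → (G.Adj u v ↔ a u ≤ b v ∧ a v ≤ b u))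
    {m : V} (hm : m ∈ L) {l : List V} (hl : l.IsChain G.Adj)
    (hlL : ∀ v ∈ l, v ∈ L ∧ m ≠ v ∧ ¬ G.Adj m v) :
    (∀ v ∈ l, b v < a m) ∨ (∀ v ∈ l, b m < a v) := by
  induction l with
  | nil => simp
  | cons u l ih =>
    have hu := hlL u (by simp)
    have hside : b u < a m ∨ b m < a u := by
      have := (h m hm u hu.1 hu.2.1).not.1 hu.2.2
      by_contra hc
      push Not at hc
      exact this hc
    cases l with
    | nil => simpa using hside
    | cons w l =>
      rw [List.isChain_cons_cons] at hl
      have hw := hlL w (by simp)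
      have huw := (h u hu.1 w hw.1 hl.1.ne).1 hl.1
      have hm' := hab m
      rcases ih hl.2 (fun v hv => hlL v (by simp [List.mem_cons.1 hv])) with ih | ih
      · left
        have := ih w (by simp)
        intro v hv
        rcases List.mem_cons.1 hv with rfl | hv
        · rcases hside with hs | hs
          · exact hs
          · linarith
        · exact ih v hv
      · right
        have := ih w (by simp)
        intro v hv
        rcases List.mem_cons.1 hv with rfl | hv
        · rcases hside with hs | hs
          · linarith
          · exact hs
        · exact ih v hv

/-- A prereduced graph has no asteroidal triple whose connecting paths use at most ten vertices
in total. -/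
theorem IsPrereduced.not_asteroidal {G : SimpleGraph V} (hG : IsPrereduced G) (L : List V)
    (hL : L.length ≤ 10) {x y z : V} {p q r : List V}
    (hp : p.IsChain G.Adj) (hxp : x ∈ p) (hyp : y ∈ p)
    (hq : q.IsChain G.Adj) (hyq : y ∈ q) (hzq : z ∈ q)
    (hr : r.IsChain G.Adj) (hxr : x ∈ r) (hzr : z ∈ r)
    (hpL : ∀ v ∈ p, v ∈ L ∧ z ≠ v ∧ ¬ G.Adj z v)
    (hqL : ∀ v ∈ q, v ∈ L ∧ x ≠ v ∧ ¬ G.Adj x v)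
    (hrL : ∀ v ∈ r, v ∈ L ∧ y ≠ v ∧ ¬ G.Adj y v) : False := by
  obtain ⟨a, b, hab, h⟩ := hG.exists_model L hL
  have hx := hab x
  have hy := hab y
  have hz := hab z
  -- Each path puts two of the intervals on the same side of the third. So none of the three
  -- disjoint intervals lies between the other two, which is impossible on a line.
  rcases forall_left_or_forall_right hab h (hqL z hzq).1 hp hpL with h1 | h1 <;>
  rcases forall_left_or_forall_right hab h (hpL x hxp).1 hq hqL with h2 | h2 <;>
  rcases forall_left_or_forall_right hab h (hpL y hyp).1 hr hrL with h3 | h3 <;>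
  · have := h1 x hxp
    have := h1 y hyp
    have := h2 y hyq
    have := h2 z hzq
    have := h3 x hxr
    have := h3 z hzr
    linarith

/-- A prereduced graph has no holes on four (`v = v'`) or five vertices. -/
theorem IsPrereduced.not_hole {G : SimpleGraph V} (hG : IsPrereduced G) {m u v v' w : V}
    (hmu : G.Adj m u) (hmw : G.Adj m w) (huv : G.Adj u v) (hvw : G.Adj w v')
    (hvv : v = v' ∨ G.Adj v v') (huw : u ≠ w) (hnuw : ¬ G.Adj u w) (hmv : m ≠ v)
    (hnmv : ¬ G.Adj m v) (hmv' : m ≠ v') (hnmv' : ¬ G.Adj m v') : False := by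
  obtain ⟨a, b, hab, h⟩ := hG.exists_model [m, u, v, v', w] (by simp)
  have h1 := (h m (by simp) u (by simp) hmu.ne).1 hmu
  have h2 := (h m (by simp) w (by simp) hmw.ne).1 hmw
  have h3 := (h u (by simp) v (by simp) huv.ne).1 huv
  have h4 := (h w (by simp) v' (by simp) hvw.ne).1 hvw
  have h5 := (h u (by simp) w (by simp) huw).not.1 hnuw
  have h6 := hab u
  have h7 := hab w
  have hm := hab m
  -- Both `u` and `w` meet `m` and reach past the same end of it, so both contain that endpoint and
  -- intersect.
  have hside : (b v < a m ∧ b v' < a m) ∨ (b m < a v ∧ b m < a v') := by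
    rcases hvv with rfl | hvv
    · rcases forall_left_or_forall_right hab h (m := m) (l := [v]) (by simp) (by simp)
        (by simp [hmv, hnmv]) with hs | hs <;> simp at hs <;> simp [hs]
    · rcases forall_left_or_forall_right hab h (m := m) (l := [v, v']) (by simp) (by simp [hvv])
        (by simp [hmv, hnmv, hmv', hnmv']) with hs | hs <;> simp at hs <;> simp [hs]
  apply h5
  rcases hside with hs | hs <;> constructor <;> linarith

/-! ### Configurations -/

/-- The vertices `b 0, …, b (d + 1)` form an induced path missed by `s`, and `c₁, c₂` are
neighbors of `s` complete to `b 1, …, b d` that miss `b (d + 1)` and `b 0`, respectively. Both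
kinds of asteroidal witnesses are of this form, with `c₁ = c₂` for the †-witness. -/
structure Config (G : SimpleGraph V) (c₁ c₂ : V) (b : ℕ → V) (d : ℕ) (s : V) : Prop where
  two_le : 2 ≤ d
  adj₁ : G.Adj s c₁
  adj₂ : G.Adj s c₂
  not_adj : ∀ i, i ≤ d + 1 → ¬ G.Adj s (b i)
  adj_base₁ : ∀ i, 1 ≤ i → i ≤ d → G.Adj c₁ (b i)
  adj_base₂ : ∀ i, 1 ≤ i → i ≤ d → G.Adj c₂ (b i)
  not_adj₁ : ¬ G.Adj c₁ (b (d + 1))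
  not_adj₂ : ¬ G.Adj c₂ (b 0)
  adj_succ : ∀ i, i ≤ d → G.Adj (b i) (b (i + 1))
  not_adj_of_lt : ∀ i j, i + 1 < j → j ≤ d + 1 → ¬ G.Adj (b i) (b j)
  ne_of_lt : ∀ i j, i < j → j ≤ d + 1 → b i ≠ b j

namespace Config

variable {G : SimpleGraph V} {c₁ c₂ s x y : V} {b : ℕ → V} {d : ℕ}

/-- Mirror symmetry: arguments about one end of the path transfer to the other. -/
theorem reverse (h : Config G c₁ c₂ b d s) :
    Config G c₂ c₁ (fun i => b (d + 1 - i)) d s where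
  two_le := h.two_le
  adj₁ := h.adj₂
  adj₂ := h.adj₁
  not_adj i _ := h.not_adj _ (by omega)
  adj_base₁ i h1 h2 := h.adj_base₂ _ (by omega) (by omega)
  adj_base₂ i h1 h2 := h.adj_base₁ _ (by omega) (by omega)
  not_adj₁ := by simpa using h.not_adj₂
  not_adj₂ := by simpa using h.not_adj₁
  adj_succ i hi := by
    have := h.adj_succ (d + 1 - (i + 1)) (by omega)
    rw [show d + 1 - (i + 1) + 1 = d + 1 - i by omega] at this
    exact this.symm
  not_adj_of_lt i j hij hj hadj := h.not_adj_of_lt (d + 1 - j) (d + 1 - i) (by omega) (by omega)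
    hadj.symm
  ne_of_lt i j hij hj he := h.ne_of_lt (d + 1 - j) (d + 1 - i) (by omega) (by omega) he.symm

/-- Every vertex of the path has a neighbor on it, while `s` has none. -/
theorem ne_base (h : Config G c₁ c₂ b d s) {i : ℕ} (hi : i ≤ d + 1) : s ≠ b i := by
  rintro rfl
  rcases Nat.lt_or_ge i (d + 1) with hlt | hge
  · exact h.not_adj (i + 1) (by omega) (h.adj_succ i (by omega))
  · obtain rfl : i = d + 1 := by omega
    exact h.not_adj d (by omega) (h.adj_succ d le_rfl).symm

theorem base_adj_iff (h : Config G c₁ c₂ b d s) {i j : ℕ} (hi : i ≤ d + 1) (hj : j ≤ d + 1) :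
    G.Adj (b i) (b j) ↔ i + 1 = j ∨ j + 1 = i := by
  constructor
  · intro hadj
    by_contra hc
    rcases lt_trichotomy i j with hlt | rfl | hlt
    · exact h.not_adj_of_lt i j (by omega) hj hadj
    · exact hadj.ne rfl
    · exact h.not_adj_of_lt j i (by omega) hi hadj.symm
  · rintro (rfl | rfl)
    · exact h.adj_succ i (by omega)
    · exact (h.adj_succ j (by omega)).symm

theorem base_ne_iff (h : Config G c₁ c₂ b d s) {i j : ℕ} (hi : i ≤ d + 1) (hj : j ≤ d + 1) :
    b i ≠ b j ↔ i ≠ j := by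
  refine ⟨fun hb hij => hb (by rw [hij]), fun hij => ?_⟩
  rcases Nat.lt_or_gt_of_ne hij with hlt | hlt
  · exact h.ne_of_lt i j hlt hj
  · exact (h.ne_of_lt j i hlt hi).symm

theorem ne₁ (h : Config G c₁ c₂ b d s) {i : ℕ} (hi : i ≤ d + 1) : c₁ ≠ b i :=
  fun he => h.not_adj i hi (he ▸ h.adj₁)

theorem ne₂ (h : Config G c₁ c₂ b d s) {i : ℕ} (hi : i ≤ d + 1) : c₂ ≠ b i :=
  fun he => h.not_adj i hi (he ▸ h.adj₂)

end Config

end IntervalDeletion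

/-! ### Forced adjacencies around the foot -/

namespace IntervalDeletion
namespace Config

variable {V : Type*}
variable {G : SimpleGraph V} {c₁ c₂ s x y : V} {b : ℕ → V} {d : ℕ}

theorem ne_base_of_not_adj (h : Config G c₁ c₂ b d s) (hx : ∀ i, i ≤ d + 1 → ¬ G.Adj x (b i))
    (i : ℕ) (hi : i ≤ d + 1) : x ≠ b i := by
  rintro rfl
  rcases Nat.lt_or_ge i (d + 1) with hlt | hge
  · exact hx (i + 1) (by omega) (h.adj_succ i (by omega))
  · obtain rfl : i = d + 1 := by omega
    exact hx d (by omega) (h.adj_succ d le_rfl).symm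

theorem base_ne (h : Config G c₁ c₂ b d s) (i : ℕ) (hi : i ≤ d + 1) : b i ≠ s :=
  (h.ne_base hi).symm

theorem base_not_adj (h : Config G c₁ c₂ b d s) (i : ℕ) (hi : i ≤ d + 1) : ¬ G.Adj (b i) s :=
  fun h' => h.not_adj i hi h'.symm

/-- A vertex adjacent to both ends of the base is adjacent to `s`. -/
theorem adj_of_common (hG : IsPrereduced G) (h : Config G c₁ c₂ b d s)
    (hy₁ : G.Adj y (b 1)) (hy₂ : G.Adj y (b d)) : G.Adj s y := by
  by_contra hsy
  have hd := h.two_le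
  have h1 := h.adj_base₁ 1 le_rfl (by omega)
  have h2 := h.adj_base₂ d (by omega) le_rfl
  have e0 : b 0 ≠ c₂ := (h.ne₂ (by omega)).symm
  have e1 : b (d + 1) ≠ c₁ := (h.ne₁ (by omega)).symm
  have e2 := h.base_ne
  have e4 : s ≠ y := by rintro rfl; exact h.not_adj 1 (by omega) hy₁
  have e5 : ∀ i, i ≤ d + 1 → s ≠ b i := fun i hi => h.ne_base hi
  have n0 : ¬ G.Adj (b 0) c₂ := fun h' => h.not_adj₂ h'.symm
  have n1 : ¬ G.Adj (b (d + 1)) c₁ := fun h' => h.not_adj₁ h'.symm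
  have n2 := h.base_not_adj
  -- The vertex `y` shortcuts the base, so the triple `s`, `b 0`, `b (d + 1)` needs only eight
  -- vertices, whatever `d` is.
  refine hG.not_asteroidal [s, y, c₁, c₂, b 0, b 1, b d, b (d + 1)] (by simp)
    (x := s) (y := b 0) (z := b (d + 1)) (p := [s, c₁, b 1, b 0])
    (q := [b 0, b 1, y, b d, b (d + 1)]) (r := [s, c₂, b d, b (d + 1)])
    ?_ (by simp) (by simp) ?_ (by simp) (by simp) ?_ (by simp) (by simp) ?_ ?_ ?_
  · simp (disch := omega) [h.adj₁, h1, h.base_adj_iff]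
  · simp (disch := omega) [h.base_adj_iff, hy₁.symm, hy₂]
  · simp (disch := omega) [h.adj₂, h2, h.base_adj_iff]
  · simp (disch := omega) [h.base_adj_iff, h.base_ne_iff, *]
    omega
  · simp (disch := omega) [h.not_adj, *]
  · simp (disch := omega) [h.base_adj_iff, h.base_ne_iff, *]
    omega

/-- A vertex adjacent to both ends of the base is adjacent to every neighbor of `s` that misses
the path. -/
theorem adj_of_common_of_adj (hG : IsPrereduced G) (h : Config G c₁ c₂ b d s)
    (hsx : G.Adj s x) (hx : ∀ i, i ≤ d + 1 → ¬ G.Adj x (b i))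
    (hy₁ : G.Adj y (b 1)) (hy₂ : G.Adj y (b d)) : G.Adj x y := by
  by_contra hxy
  have hd := h.two_le
  have h1 := h.adj_base₁ 1 le_rfl (by omega)
  have h2 := h.adj_base₂ d (by omega) le_rfl
  have e0 : b 0 ≠ c₂ := (h.ne₂ (by omega)).symm
  have e1 : b (d + 1) ≠ c₁ := (h.ne₁ (by omega)).symm
  have e2 := h.base_ne
  have e3 : ∀ i, i ≤ d + 1 → b i ≠ x := fun i hi => (h.ne_base_of_not_adj hx i hi).symm
  have e4 : x ≠ y := by rintro rfl; exact hx 1 (by omega) hy₁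
  have e5 := h.ne_base_of_not_adj hx
  have n0 : ¬ G.Adj (b 0) c₂ := fun h' => h.not_adj₂ h'.symm
  have n1 : ¬ G.Adj (b (d + 1)) c₁ := fun h' => h.not_adj₁ h'.symm
  have n2 := h.base_not_adj
  have n3 : ∀ i, i ≤ d + 1 → ¬ G.Adj (b i) x := fun i hi h' => hx i hi h'.symm
  -- The same shortcut, with `x` attached behind `s`: nine vertices.
  refine hG.not_asteroidal [x, s, y, c₁, c₂, b 0, b 1, b d, b (d + 1)] (by simp)
    (x := x) (y := b 0) (z := b (d + 1)) (p := [x, s, c₁, b 1, b 0])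
    (q := [b 0, b 1, y, b d, b (d + 1)]) (r := [x, s, c₂, b d, b (d + 1)])
    ?_ (by simp) (by simp) ?_ (by simp) (by simp) ?_ (by simp) (by simp) ?_ ?_ ?_
  · simp (disch := omega) [h.adj₁, h1, h.base_adj_iff, hsx.symm]
  · simp (disch := omega) [h.base_adj_iff, hy₁.symm, hy₂]
  · simp (disch := omega) [h.adj₂, h2, h.base_adj_iff, hsx.symm]
  · simp (disch := omega) [h.base_adj_iff, h.base_ne_iff, *]
    omega
  · simp (disch := omega) [*]
  · simp (disch := omega) [h.base_adj_iff, h.base_ne_iff, *]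
    omega

/-- Both `c₁` and `c₂` are adjacent to the two ends of the base, hence to `x` by
`adj_of_common_of_adj`. This lets the foot move along edges. -/
theorem of_adj (hG : IsPrereduced G) (h : Config G c₁ c₂ b d s)
    (hsx : G.Adj s x) (hx : ∀ i, i ≤ d + 1 → ¬ G.Adj x (b i)) : Config G c₁ c₂ b d x where
  two_le := h.two_le
  adj₁ := h.adj_of_common_of_adj hG hsx hx (h.adj_base₁ 1 le_rfl (by linarith [h.two_le]))
    (h.adj_base₁ d (by linarith [h.two_le]) le_rfl)
  adj₂ := h.adj_of_common_of_adj hG hsx hx (h.adj_base₂ 1 le_rfl (by linarith [h.two_le]))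
    (h.adj_base₂ d (by linarith [h.two_le]) le_rfl)
  not_adj := hx
  adj_base₁ := h.adj_base₁
  adj_base₂ := h.adj_base₂
  not_adj₁ := h.not_adj₁
  not_adj₂ := h.not_adj₂
  adj_succ := h.adj_succ
  not_adj_of_lt := h.not_adj_of_lt
  ne_of_lt := h.ne_of_lt

/-- For `d ≤ 5` the whole configuration has at most `d + 5 ≤ 10` vertices, and `s`, `b 0`, `b (d +
1)` form an asteroidal triple in it. -/
theorem six_le (hG : IsPrereduced G) (h : Config G c₁ c₂ b d s) : 6 ≤ d := by
  by_contra hd6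
  have hd := h.two_le
  have h1 := h.adj_base₁ 1 le_rfl (by omega)
  have h2 := h.adj_base₂ d (by omega) le_rfl
  have e0 : b 0 ≠ c₂ := (h.ne₂ (by omega)).symm
  have e1 : b (d + 1) ≠ c₁ := (h.ne₁ (by omega)).symm
  have e2 := h.base_ne
  have n0 : ¬ G.Adj (b 0) c₂ := fun h' => h.not_adj₂ h'.symm
  have n1 : ¬ G.Adj (b (d + 1)) c₁ := fun h' => h.not_adj₁ h'.symm
  have n2 := h.base_not_adj
  have hmem : ∀ i, i ≤ d + 1 → b i ∈ (List.range (d + 2)).map b :=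
    fun i hi => List.mem_map.2 ⟨i, by simp; omega, rfl⟩
  refine hG.not_asteroidal (s :: c₁ :: c₂ :: (List.range (d + 2)).map b) (by simp; omega)
    (x := s) (y := b 0) (z := b (d + 1)) (p := [s, c₁, b 1, b 0])
    (q := (List.range (d + 2)).map b) (r := [s, c₂, b d, b (d + 1)])
    ?_ (by simp) (by simp) ?_ (hmem _ (by omega)) (hmem _ (by omega)) ?_ (by simp) (by simp)
    ?_ ?_ ?_
  · simp (disch := omega) [h.adj₁, h1, h.base_adj_iff]
  · rw [List.isChain_map, List.isChain_iff_getElem]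
    intro i hi
    simp only [List.length_range, List.getElem_range] at hi ⊢
    exact h.adj_succ i (by omega)
  · simp (disch := omega) [h.adj₂, h2, h.base_adj_iff]
  · have := hmem 0 (by omega)
    have := hmem 1 (by omega)
    simp (disch := omega) [-List.mem_map, h.base_adj_iff, h.base_ne_iff, *]
    omega
  · intro v hv
    refine ⟨by simp only [List.mem_cons, hv, or_true], ?_⟩
    obtain ⟨i, hi, rfl⟩ := List.mem_map.1 hv
    rw [List.mem_range] at hi
    exact ⟨h.ne_base (by omega), h.not_adj i (by omega)⟩
  · have := hmem d (by omega)
    have := hmem (d + 1) (by omega)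
    simp (disch := omega) [-List.mem_map, h.base_adj_iff, h.base_ne_iff, *]
    omega

theorem neighbor_ne_base (h : Config G c₁ c₂ b d s) (hsx : G.Adj s x) (i : ℕ) (hi : i ≤ d + 1) :
    x ≠ b i := by
  rintro rfl
  exact h.not_adj i hi hsx

/-- Case of `not_adj_single` for the first half of the path. -/
theorem not_adj_single_of_lt (hG : IsPrereduced G) (h : Config G c₁ c₂ b d s) (hsx : G.Adj s x)
    {p : ℕ} (hp : p < d) (hxp : G.Adj x (b p)) (hl : p = 0 ∨ ¬ G.Adj x (b (p - 1)))
    (hr : ¬ G.Adj x (b (p + 1))) : False := by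
  have hd := h.six_le hG
  have e2 := h.base_ne
  have e3 : ∀ i, i ≤ d + 1 → b i ≠ x := fun i hi => (h.neighbor_ne_base hsx i hi).symm
  have e4 := h.neighbor_ne_base hsx
  have e5 : ∀ i, i ≤ d + 1 → s ≠ b i := fun i hi => h.ne_base hi
  have n2 := h.base_not_adj
  rcases Nat.eq_zero_or_pos p with rfl | hp0
  · have h1 := h.adj_base₂ 1 le_rfl (by omega)
    have h0 := h.adj_succ 0 (by omega)
    simp only [Nat.zero_add] at hr h0
    -- Either `x, b 0, b 1, c₂` is a 4-hole or `c₂, s, x, b 0, b 1` is a 5-hole.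
    by_cases hxc : G.Adj x c₂
    · exact hG.not_hole hxp hxc h0 h1 (Or.inl rfl) ((h.ne₂ (by omega)).symm)
        (fun h' => h.not_adj₂ h'.symm) (e4 1 (by omega)) hr (e4 1 (by omega)) hr
    · refine hG.not_hole (m := c₂) (u := s) (w := b 1) (v := x) (v' := b 0) h.adj₂.symm h1 hsx
        h0.symm (Or.inr hxp) (e5 1 (by omega)) (h.not_adj 1 (by omega)) ?_
        (fun h' => hxc h'.symm) (h.ne₂ (by omega)) h.not_adj₂
      rintro rfl
      exact h.not_adj₂ hxp
  have hl : ¬ G.Adj x (b (p - 1)) := by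
    rcases hl with rfl | hl
    · omega
    · exact hl
  have hr2 : ¬ G.Adj x (b (p + 2)) := fun h' =>
    hG.not_hole hxp h' (h.adj_succ p (by omega)) (h.adj_succ (p + 1) (by omega)).symm
      (Or.inl rfl) ((h.base_ne_iff (by omega) (by omega)).2 (by omega))
      (h.not_adj_of_lt _ _ (by omega) (by omega)) (e4 _ (by omega)) hr (e4 _ (by omega)) hr
  have m1 : ¬ G.Adj (b (p - 1)) x := fun h' => hl h'.symm
  have m2 : ¬ G.Adj (b (p + 2)) x := fun h' => hr2 h'.symm
  -- For `p = 1` the path is too short on the left, and `c₂` supplies a route from `s` to `b 3`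
  -- avoiding the neighbors of `b 0`. For `p ≥ 2` there is a claw centered at `b p` with all legs of
  -- length two.
  rcases Nat.lt_or_ge p 2 with hp2 | hp2
  · obtain rfl : p = 1 := by omega
    simp only [Nat.sub_self] at m1
    simp only [Nat.reduceAdd] at m2
    have h3 := h.adj_base₂ 3 (by omega) (by omega)
    have e0 : b 0 ≠ c₂ := (h.ne₂ (by omega)).symm
    have n0 : ¬ G.Adj (b 0) c₂ := fun h' => h.not_adj₂ h'.symm
    refine hG.not_asteroidal [s, x, c₂, b 0, b 1, b 2, b 3] (by simp)
      (x := s) (y := b 0) (z := b 3) (p := [s, x, b 1, b 0])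
      (q := [b 0, b 1, b 2, b 3]) (r := [s, c₂, b 3])
      ?_ (by simp) (by simp) ?_ (by simp) (by simp) ?_ (by simp) (by simp) ?_ ?_ ?_
    · simp (disch := omega) [h.base_adj_iff, *]
    · simp (disch := omega) [h.base_adj_iff]
    · simp (disch := omega) [h.adj₂, h3]
    · simp (disch := omega) [h.base_adj_iff, h.base_ne_iff, *]
    · simp (disch := omega) [h.not_adj, *]
    · simp (disch := omega) [h.base_adj_iff, h.base_ne_iff, *]
  · obtain ⟨k, rfl⟩ := Nat.exists_eq_add_of_le' hp2
    have e1 : k + 2 - 1 = k + 1 := by omega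
    rw [e1] at hl m1
    have hl2 : ¬ G.Adj x (b k) := fun h' =>
      hG.not_hole hxp h' (h.adj_succ (k + 1) (by omega)).symm (h.adj_succ k (by omega))
        (Or.inl rfl) ((h.base_ne_iff (by omega) (by omega)).2 (by omega))
        (fun h' => h.not_adj_of_lt _ _ (by omega) (by omega) h'.symm) (e4 _ (by omega)) hl
        (e4 _ (by omega)) hl
    have m3 : ¬ G.Adj (b k) x := fun h' => hl2 h'.symm
    refine hG.not_asteroidal [s, x, b k, b (k + 1), b (k + 2), b (k + 2 + 1), b (k + 2 + 2)]
      (by simp) (x := s) (y := b k) (z := b (k + 2 + 2)) (p := [s, x, b (k + 2), b (k + 1), b k])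
      (q := [b k, b (k + 1), b (k + 2), b (k + 2 + 1), b (k + 2 + 2)])
      (r := [s, x, b (k + 2), b (k + 2 + 1), b (k + 2 + 2)])
      ?_ (by simp) (by simp) ?_ (by simp) (by simp) ?_ (by simp) (by simp) ?_ ?_ ?_
    · simp (disch := omega) [h.base_adj_iff, *]
    · simp (disch := omega) [h.base_adj_iff]
    · simp (disch := omega) [h.base_adj_iff, *]
    · simp (disch := omega) [h.base_adj_iff, h.base_ne_iff, *]
      omega
    · simp (disch := omega) [h.not_adj, *]
    · simp (disch := omega) [h.base_adj_iff, h.base_ne_iff, *]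
      omega

/-- No vertex on the path is an isolated neighbor of a neighbor of `s`. -/
theorem not_adj_single (hG : IsPrereduced G) (h : Config G c₁ c₂ b d s) (hsx : G.Adj s x)
    {p : ℕ} (hp : p ≤ d + 1) (hxp : G.Adj x (b p)) (hl : p = 0 ∨ ¬ G.Adj x (b (p - 1)))
    (hr : p = d + 1 ∨ ¬ G.Adj x (b (p + 1))) : False := by
  have hd := h.two_le
  rcases Nat.lt_or_ge p d with hpd | hpd
  · exact h.not_adj_single_of_lt hG hsx hpd hxp hl (hr.resolve_left (by omega))
  · refine h.reverse.not_adj_single_of_lt hG hsx (p := d + 1 - p) (by omega) ?_ ?_ ?_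
    · simpa only [show d + 1 - (d + 1 - p) = p by omega] using hxp
    · rcases hr with rfl | hr
      · simp
      · rcases Nat.lt_or_ge p (d + 1) with hlt | hge
        · right
          simpa only [show d + 1 - (d + 1 - p - 1) = p + 1 by omega] using hr
        · left; omega
    · simpa only [show d + 1 - (d + 1 - p + 1) = p - 1 by omega] using hl.resolve_left (by omega)

end Config

/-- Every index satisfying `P` lies in a maximal run of such indices. -/
theorem exists_maximal_run (P : ℕ → Prop) {i n : ℕ} (hi : i ≤ n) (hP : P i) :
    ∃ p q, p ≤ i ∧ i ≤ q ∧ q ≤ n ∧ (∀ j, p ≤ j → j ≤ q → P j) ∧ (p = 0 ∨ ¬ P (p - 1)) ∧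
      (q = n ∨ ¬ P (q + 1)) := by
  have hleft : ∃ p, p ≤ i ∧ (∀ j, p ≤ j → j ≤ i → P j) ∧ (p = 0 ∨ ¬ P (p - 1)) := by
    clear hi
    induction i with
    | zero => exact ⟨0, le_rfl, fun j _ hj => by rwa [Nat.le_zero.1 hj], Or.inl rfl⟩
    | succ i ih =>
      by_cases hPi : P i
      · obtain ⟨p, hp, hall, hend⟩ := ih hPi
        refine ⟨p, by omega, fun j hj hji => ?_, hend⟩
        rcases Nat.lt_or_ge j (i + 1) with hlt | hge
        · exact hall j hj (by omega)
        · rwa [show j = i + 1 by omega]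
      · exact ⟨i + 1, le_rfl, fun j h1 h2 => by rwa [show j = i + 1 by omega],
          Or.inr (by simpa using hPi)⟩
  have hright : ∃ q, i ≤ q ∧ q ≤ n ∧ (∀ j, i ≤ j → j ≤ q → P j) ∧ (q = n ∨ ¬ P (q + 1)) := by
    clear hleft
    obtain ⟨k, rfl⟩ := Nat.exists_eq_add_of_le hi
    clear hi
    induction k generalizing i with
    | zero => exact ⟨i, le_rfl, le_rfl, fun j h1 h2 => by rwa [show j = i by omega], Or.inl rfl⟩
    | succ k ih =>
      by_cases hPi : P (i + 1)
      · obtain ⟨q, hq, hqn, hall, hend⟩ := ih hPi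
        refine ⟨q, by omega, by omega, fun j hj hjq => ?_, by
          rwa [show i + 1 + k = i + (k + 1) by omega] at hend⟩
        rcases Nat.eq_or_lt_of_le hj with rfl | hlt
        · exact hP
        · exact hall j hlt hjq
      · exact ⟨i, le_rfl, by omega, fun j h1 h2 => by rwa [show j = i by omega], Or.inr hPi⟩
  obtain ⟨p, hp, hpall, hpend⟩ := hleft
  obtain ⟨q, hq, hqn, hqall, hqend⟩ := hright
  refine ⟨p, q, hp, hq, hqn, fun j h1 h2 => ?_, hpend, hqend⟩
  rcases le_total j i with hji | hji
  · exact hpall j h1 hji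
  · exact hqall j hji h2

end IntervalDeletion

/-! ### Runs of neighbors along the path and shorter configurations -/

namespace IntervalDeletion
namespace Config

variable {V : Type*}
variable {G : SimpleGraph V} {c₁ c₂ s x y : V} {b : ℕ → V} {d : ℕ}

/-- Otherwise `s`, `b 0`, `b 2` form an asteroidal triple. This excludes the run `b 0, b 1`, whose
base would have length one, below the bound `two_le`. -/
theorem adj_two_of_adj_zero (hG : IsPrereduced G) (h : Config G c₁ c₂ b d s) (hsx : G.Adj s x)
    (h0 : G.Adj x (b 0)) : G.Adj x (b 2) := by
  by_contra hx2
  have hd := h.six_le hG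
  have e0 : b 0 ≠ c₂ := (h.ne₂ (by omega)).symm
  have e2 := h.base_ne
  have e3 : ∀ i, i ≤ d + 1 → b i ≠ x := fun i hi => (h.neighbor_ne_base hsx i hi).symm
  have e5 : ∀ i, i ≤ d + 1 → s ≠ b i := fun i hi => h.ne_base hi
  have n0 : ¬ G.Adj (b 0) c₂ := fun h' => h.not_adj₂ h'.symm
  have n2 := h.base_not_adj
  have m2 : ¬ G.Adj (b 2) x := fun h' => hx2 h'.symm
  have h2 := h.adj_base₂ 2 (by omega) (by omega)
  refine hG.not_asteroidal [s, x, c₂, b 0, b 1, b 2] (by simp)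
    (x := s) (y := b 0) (z := b 2) (p := [s, x, b 0]) (q := [b 0, b 1, b 2]) (r := [s, c₂, b 2])
    ?_ (by simp) (by simp) ?_ (by simp) (by simp) ?_ (by simp) (by simp) ?_ ?_ ?_
  · simp [hsx, h0]
  · simp (disch := omega) [h.base_adj_iff]
  · simp [h.adj₂, h2]
  · simp (disch := omega) [h.base_adj_iff, h.base_ne_iff, *]
  · simp (disch := omega) [h.not_adj, *]
  · simp (disch := omega) [h.base_adj_iff, h.base_ne_iff, *]

/-- A neighbor of `s` that has neighbors on the path is complete to the base, or one of its runs
of neighbors on the path gives a smaller configuration. -/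
theorem neighbor_cases (hG : IsPrereduced G) (h : Config G c₁ c₂ b d s) (hsx : G.Adj s x)
    {i : ℕ} (hi : i ≤ d + 1) (hxi : G.Adj x (b i)) :
    (∀ j, 1 ≤ j → j ≤ d → G.Adj x (b j)) ∨
    (∃ k q, k + 2 ≤ q ∧ q ≤ d ∧ q < d + k ∧ (∀ j, k + 1 ≤ j → j ≤ q → G.Adj x (b j)) ∧
      ¬ G.Adj x (b k) ∧ ¬ G.Adj x (b (q + 1))) ∨
    (∃ q, 2 ≤ q ∧ q < d ∧ (∀ j, j ≤ q → G.Adj x (b j)) ∧ ¬ G.Adj x (b (q + 1))) ∨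
    (∃ q, 2 ≤ q ∧ q < d ∧ (∀ j, j ≤ q → G.Adj x (b (d + 1 - j))) ∧
      ¬ G.Adj x (b (d + 1 - (q + 1)))) := by
  have hd := h.six_le hG
  obtain ⟨p, q, hpi, hiq, hqn, hall, hp, hq⟩ :=
    exists_maximal_run (fun j => G.Adj x (b j)) hi hxi
  -- A run that is not full gives a new base strictly shorter than `d`: of length `q - k`, `q` or,
  -- after reflection, `d - k`.
  by_cases hfull : p ≤ 1 ∧ d ≤ q
  · exact Or.inl fun j h1 h2 => hall j (by omega) (by omega)
  right
  have hpq : p < q := by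
    by_contra hpq
    obtain rfl : p = q := by omega
    exact h.not_adj_single hG hsx hqn (hall p le_rfl le_rfl) hp hq
  rcases Nat.eq_zero_or_pos p with rfl | hp0
  · right; left
    have hq' := hq.resolve_left (by omega)
    refine ⟨q, ?_, by omega, fun j hj => hall j (by omega) hj, hq'⟩
    by_contra hq2
    obtain rfl : q = 1 := by omega
    exact hq' (h.adj_two_of_adj_zero hG hsx (hall 0 le_rfl (by omega)))
  have hp' := hp.resolve_left (by omega)
  obtain ⟨k, rfl⟩ := Nat.exists_eq_add_of_le' hp0
  rw [Nat.add_sub_cancel] at hp'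
  rcases Nat.lt_or_ge q (d + 1) with hqd | hqd
  · left
    exact ⟨k, q, by omega, by omega, by omega, hall, hp', hq.resolve_left (by omega)⟩
  · right; right
    obtain rfl : q = d + 1 := by omega
    have hrun : ∀ j, j ≤ d - k → G.Adj x (b (d + 1 - j)) := fun j hj =>
      hall _ (by omega) (by omega)
    have hend : ¬ G.Adj x (b (d + 1 - (d - k + 1))) := by
      rwa [show d + 1 - (d - k + 1) = k by omega]
    refine ⟨d - k, ?_, by omega, hrun, hend⟩
    by_contra hq2
    have hk : d - k = 1 := by omega
    rw [hk] at hrun hend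
    exact hend (h.reverse.adj_two_of_adj_zero hG hsx (hrun 0 (by omega)))

/-- Here `x` replaces `c₁`, and `c₂` is kept because it still has to miss `b 0`, which `x` sees. -/
theorem of_initial_run (h : Config G c₁ c₂ b d s) (hsx : G.Adj s x) {q : ℕ} (hq : 2 ≤ q)
    (hqd : q < d) (hall : ∀ j, j ≤ q → G.Adj x (b j)) (hend : ¬ G.Adj x (b (q + 1))) :
    Config G x c₂ b q s where
  two_le := hq
  adj₁ := hsx
  adj₂ := h.adj₂
  not_adj i hi := h.not_adj i (by omega)
  adj_base₁ i _ h2 := hall i h2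
  adj_base₂ i h1 h2 := h.adj_base₂ i h1 (by omega)
  not_adj₁ := hend
  not_adj₂ := h.not_adj₂
  adj_succ i hi := h.adj_succ i (by omega)
  not_adj_of_lt i j h1 h2 := h.not_adj_of_lt i j h1 (by omega)
  ne_of_lt i j h1 h2 := h.ne_of_lt i j h1 (by omega)

/-- Missing both ends of its run, `x` plays both roles `c₁` and `c₂`, as in a †-witness. -/
theorem of_inner_run (h : Config G c₁ c₂ b d s) (hsx : G.Adj s x) {k q : ℕ} (hkq : k + 2 ≤ q)
    (hqd : q ≤ d) (hall : ∀ j, k + 1 ≤ j → j ≤ q → G.Adj x (b j)) (hl : ¬ G.Adj x (b k))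
    (hr : ¬ G.Adj x (b (q + 1))) : Config G x x (fun i => b (k + i)) (q - k) s where
  two_le := by omega
  adj₁ := hsx
  adj₂ := hsx
  not_adj i hi := h.not_adj _ (by omega)
  adj_base₁ i h1 h2 := hall _ (by omega) (by omega)
  adj_base₂ i h1 h2 := hall _ (by omega) (by omega)
  not_adj₁ := by rwa [show k + (q - k + 1) = q + 1 by omega]
  not_adj₂ := by simpa using hl
  adj_succ i hi := h.adj_succ (k + i) (by omega)
  not_adj_of_lt i j h1 h2 := h.not_adj_of_lt _ _ (by omega) (by omega)
  ne_of_lt i j h1 h2 := h.ne_of_lt _ _ (by omega) (by omega)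

/-- If the base is shortest possible, a neighbor of `s` with neighbors on the path is complete to
the base. -/
theorem adj_base_of_minimal (hG : IsPrereduced G) (h : Config G c₁ c₂ b d s)
    (hmin : ∀ c₁' c₂' b' d', Config G c₁' c₂' b' d' s → d ≤ d') (hsx : G.Adj s x)
    {i : ℕ} (hi : i ≤ d + 1) (hxi : G.Adj x (b i)) {j : ℕ} (hj1 : 1 ≤ j) (hjd : j ≤ d) :
    G.Adj x (b j) := by
  rcases h.neighbor_cases hG hsx hi hxi with hc | ⟨k, q, h1, h2, h3, h4, h5, h6⟩ |
    ⟨q, h1, h2, h3, h4⟩ | ⟨q, h1, h2, h3, h4⟩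
  · exact hc j hj1 hjd
  · have := hmin _ _ _ _ (h.of_inner_run hsx h1 h2 h4 h5 h6)
    omega
  · have := hmin _ _ _ _ (h.of_initial_run hsx h1 h2 h3 h4)
    omega
  · have := hmin _ _ _ _ (h.reverse.of_initial_run hsx h1 h2 h3 h4)
    omega

/-- Otherwise `s`, `b 0`, `b (q + 1)` form an asteroidal triple: `y` shortcuts the run, and `c₂`
joins `s` to `b (q + 1)`. -/
theorem adj_of_initial_run (hG : IsPrereduced G) (h : Config G c₁ c₂ b d s)
    (hx : Config G c₁ c₂ b d x) (hsx : G.Adj s x) (hxy : G.Adj x y) {q : ℕ} (hq : 2 ≤ q)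
    (hqd : q < d) (hall : ∀ j, j ≤ q → G.Adj y (b j)) (hend : ¬ G.Adj y (b (q + 1))) :
    G.Adj s y := by
  by_contra hsy
  have e0 : b 0 ≠ c₂ := (h.ne₂ (by omega)).symm
  have e1 := h.base_ne
  have e2 := hx.base_ne
  have e3 : ∀ i, i ≤ d + 1 → b i ≠ y := fun i hi => (hx.neighbor_ne_base hxy i hi).symm
  have e4 : s ≠ y := by rintro rfl; exact h.not_adj 0 (by omega) (hall 0 (by omega))
  have e5 : ∀ i, i ≤ d + 1 → s ≠ b i := fun i hi => h.ne_base hi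
  have n0 : ¬ G.Adj (b 0) c₂ := fun h' => h.not_adj₂ h'.symm
  have n1 := h.base_not_adj
  have n2 := hx.base_not_adj
  have m2 : ¬ G.Adj (b (q + 1)) y := fun h' => hend h'.symm
  have h1 := hall 0 (by omega)
  have h2 := hall q (by omega)
  have h3 := h.adj_base₂ (q + 1) (by omega) (by omega)
  refine hG.not_asteroidal [s, x, y, c₂, b 0, b q, b (q + 1)] (by simp)
    (x := s) (y := b 0) (z := b (q + 1)) (p := [s, x, y, b 0])
    (q := [b 0, y, b q, b (q + 1)]) (r := [s, c₂, b (q + 1)])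
    ?_ (by simp) (by simp) ?_ (by simp) (by simp) ?_ (by simp) (by simp) ?_ ?_ ?_
  · simp [hsx, hxy, h1]
  · simp (disch := omega) [h.base_adj_iff, h1.symm, h2]
  · simp [h.adj₂, h3]
  · simp (disch := omega) [h.base_adj_iff, h.base_ne_iff, *]
    omega
  · simp (disch := omega) [h.not_adj, *]
  · simp (disch := omega) [h.base_adj_iff, h.base_ne_iff, *]
    omega

/-- Otherwise `s`, `b k`, `b (q + 1)` form an asteroidal triple, with all three connecting paths
through `y`. -/
theorem adj_of_inner_run (hG : IsPrereduced G) (h : Config G c₁ c₂ b d s)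
    (hx : Config G c₁ c₂ b d x) (hsx : G.Adj s x) (hxy : G.Adj x y) {k q : ℕ} (hkq : k + 2 ≤ q)
    (hqd : q ≤ d) (hall : ∀ j, k + 1 ≤ j → j ≤ q → G.Adj y (b j)) (hl : ¬ G.Adj y (b k))
    (hr : ¬ G.Adj y (b (q + 1))) : G.Adj s y := by
  by_contra hsy
  have e1 := h.base_ne
  have e2 := hx.base_ne
  have e3 : ∀ i, i ≤ d + 1 → b i ≠ y := fun i hi => (hx.neighbor_ne_base hxy i hi).symm
  have e4 : s ≠ y := by
    rintro rfl; exact h.not_adj q (by omega) (hall q (by omega) (by omega))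
  have e5 : ∀ i, i ≤ d + 1 → s ≠ b i := fun i hi => h.ne_base hi
  have n1 := h.base_not_adj
  have n2 := hx.base_not_adj
  have m1 : ¬ G.Adj (b k) y := fun h' => hl h'.symm
  have m2 : ¬ G.Adj (b (q + 1)) y := fun h' => hr h'.symm
  have h1 := hall (k + 1) le_rfl (by omega)
  have h2 := hall q (by omega) le_rfl
  refine hG.not_asteroidal [s, x, y, b k, b (k + 1), b q, b (q + 1)] (by simp)
    (x := s) (y := b k) (z := b (q + 1)) (p := [s, x, y, b (k + 1), b k])
    (q := [b k, b (k + 1), y, b q, b (q + 1)]) (r := [s, x, y, b q, b (q + 1)])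
    ?_ (by simp) (by simp) ?_ (by simp) (by simp) ?_ (by simp) (by simp) ?_ ?_ ?_
  · simp (disch := omega) [h.base_adj_iff, *]
  · simp (disch := omega) [h.base_adj_iff, h1.symm, h2]
  · simp (disch := omega) [h.base_adj_iff, *]
  · simp (disch := omega) [h.base_adj_iff, h.base_ne_iff, *]
    omega
  · simp (disch := omega) [h.not_adj, *]
  · simp (disch := omega) [h.base_adj_iff, h.base_ne_iff, *]
    omega

/-- Adjacent feet of the same configuration have the same neighbors with neighbors on the path. -/
theorem adj_of_adj_of_adj (hG : IsPrereduced G) (h : Config G c₁ c₂ b d s)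
    (hx : Config G c₁ c₂ b d x) (hsx : G.Adj s x) (hxy : G.Adj x y) {i : ℕ} (hi : i ≤ d + 1)
    (hyi : G.Adj y (b i)) : G.Adj s y := by
  rcases hx.neighbor_cases hG hxy hi hyi with hc | ⟨k, q, h1, h2, h3, h4, h5, h6⟩ |
    ⟨q, h1, h2, h3, h4⟩ | ⟨q, h1, h2, h3, h4⟩
  · have hd := h.two_le
    exact h.adj_of_common hG (hc 1 le_rfl (by omega)) (hc d (by omega) le_rfl)
  · exact h.adj_of_inner_run hG hx hsx hxy h1 h2 h4 h5 h6
  · exact h.adj_of_initial_run hG hx hsx hxy h1 h2 h3 h4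
  · exact h.reverse.adj_of_initial_run hG hx.reverse hsx hxy h1 h2 h3 h4

/-- In a reduced graph, the foot of a configuration with shortest base is simplicial. -/
theorem isSimplicial_of_minimal (hG : IsReduced G) (h : Config G c₁ c₂ b d s)
    (hmin : ∀ c₁' c₂' b' d', Config G c₁' c₂' b' d' s → d ≤ d') : IsSimplicial G s := by
  have hpre := hG.1
  have hd := h.six_le hpre
  set A : Set V := {y | G.Adj s y ∧ ∃ i, i ≤ d + 1 ∧ G.Adj y (b i)} with hA
  have hbase : ∀ y ∈ A, ∀ j, 1 ≤ j → j ≤ d → G.Adj y (b j) := by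
    rintro y ⟨hsy, i, hi, hyi⟩ j h1 h2
    exact h.adj_base_of_minimal hpre hmin hsy hi hyi h1 h2
  set M : Set V := {v | Relation.ReflTransGen (fun u v => G.Adj u v ∧ v ∉ A) s v} with hM
  -- Minimality is known only for `s`. The second conjunct brings every path-touching neighbor of a
  -- member of `M` back into `A`, so `hbase` remains available along the walk.
  have hmem : ∀ v ∈ M, Config G c₁ c₂ b d v ∧
      ∀ y i, G.Adj v y → i ≤ d + 1 → G.Adj y (b i) → y ∈ A := by
    intro v hv
    induction hv with
    | refl => exact ⟨h, fun y i hsy hi hyi => ⟨hsy, i, hi, hyi⟩⟩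
    | tail _ huv ih =>
      have hv := ih.1.of_adj hpre huv.1 (fun i hi hvi => huv.2 (ih.2 _ i huv.1 hi hvi))
      exact ⟨hv, fun y i hvy hi hyi =>
        ih.2 y i (ih.1.adj_of_adj_of_adj hpre hv huv.1 hvy hi hyi) hi hyi⟩
  have hAM : ∀ y ∈ A, ∀ v ∈ M, G.Adj v y := fun y hy v hv =>
    (hmem v hv).1.adj_of_common hpre (hbase y hy 1 le_rfl (by omega))
      (hbase y hy d (by omega) le_rfl)
  have hout : ∀ v ∈ M, ∀ y, y ∉ M → G.Adj v y → y ∈ A := by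
    intro v hv y hy hvy
    by_contra hyA
    exact hy (Relation.ReflTransGen.tail hv ⟨hvy, hyA⟩)
  have hsM : s ∈ M := Relation.ReflTransGen.refl
  have hmod : IsModule G M := fun u hu v hv y hy =>
    ⟨fun huy => hAM y (hout u hu y hy huy) v hv, fun hvy => hAM y (hout v hv y hy hvy) u hu⟩
  -- Members of `M` miss the path, but `b 0` sees `b 1`.
  have huniv : M ≠ Set.univ := fun hM' =>
    (hmem (b 0) (hM' ▸ Set.mem_univ _)).1.not_adj 1 (by omega) (h.adj_succ 0 (by omega))
  have hMclique : ∀ u ∈ M, ∀ v ∈ M, u ≠ v → G.Adj u v := fun u hu v hv huv =>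
    hG.2 M ⟨hmod, ⟨u, hu, v, hv, huv⟩, huniv⟩ hu hv huv
  have hAclique : ∀ u ∈ A, ∀ v ∈ A, u ≠ v → G.Adj u v := by
    intro u hu v hv huv
    by_contra hn
    have h1 := hbase u hu
    have h2 := hbase v hv
    -- The 4-hole `b 1, u, b 3, v`; any two nonadjacent base vertices would serve.
    exact hpre.not_hole (h1 1 le_rfl (by omega)).symm (h2 1 le_rfl (by omega)).symm
      (h1 3 (by omega) (by omega)) (h2 3 (by omega) (by omega)) (Or.inl rfl) huv hn
      (h.ne_of_lt 1 3 (by omega) (by omega)) (h.not_adj_of_lt 1 3 (by omega) (by omega))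
      (h.ne_of_lt 1 3 (by omega) (by omega)) (h.not_adj_of_lt 1 3 (by omega) (by omega))
  have hcover : ∀ y, G.Adj s y → y ∈ A ∨ y ∈ M := fun y hsy => by
    by_cases hyM : y ∈ M
    · exact Or.inr hyM
    · exact Or.inl (hout s hsM y hyM hsy)
  intro u hu v hv huv
  rcases hcover u hu with hu | hu <;> rcases hcover v hv with hv | hv
  · exact hAclique u hu v hv huv
  · exact (hAM u hu v hv).symm
  · exact hAM v hv u hu
  · exact hMclique u hu v hv huv

theorem isSimplicial (hG : IsReduced G) (h : Config G c₁ c₂ b d s) : IsSimplicial G s := by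
  classical
  -- The length comes first so that `Nat.find` minimizes it over all configurations with foot `s`.
  have hex : ∃ d c₁ c₂ b, Config G c₁ c₂ b d s := ⟨d, c₁, c₂, b, h⟩
  obtain ⟨c₁', c₂', b', h'⟩ := Nat.find_spec hex
  exact h'.isSimplicial_of_minimal hG fun _ _ _ _ h'' => Nat.find_min' hex ⟨_, _, _, h''⟩

end Config
end IntervalDeletion

namespace IntervalDeletion

variable {V : Type*}

/-! ### Shallow terminals -/

theorem InducesPath.exists_adj {G : SimpleGraph V} {X : Set V} (h : InducesPath G X) {u v : V}
    (hu : u ∈ X) (hv : v ∈ X) (huv : u ≠ v) : ∃ w ∈ X, G.Adj u w := by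
  obtain ⟨n, ⟨f⟩⟩ := h
  have hc : (G.induce X).Preconnected :=
    f.symm.connected_iff.1 (SimpleGraph.pathGraph_connected n) |>.preconnected
  have : Nontrivial X := ⟨⟨u, hu⟩, ⟨v, hv⟩, by simpa using huv⟩
  obtain ⟨w, hw⟩ := hc.exists_adj_of_nontrivial ⟨u, hu⟩
  exact ⟨w, w.2, hw⟩

theorem InducesPath.not_triangle {G : SimpleGraph V} {X : Set V} (h : InducesPath G X) {u v w : V}
    (hu : u ∈ X) (hv : v ∈ X) (hw : w ∈ X) (huv : G.Adj u v) (huw : G.Adj u w)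
    (hvw : G.Adj v w) : False := by
  obtain ⟨n, ⟨f⟩⟩ := h
  have key : ∀ a c : X, G.Adj a c → (f a).val + 1 = (f c).val ∨ (f c).val + 1 = (f a).val :=
    fun a c hac => SimpleGraph.pathGraph_adj.1 (f.map_adj_iff.2 hac)
  have h1 := key ⟨u, hu⟩ ⟨v, hv⟩ huv
  have h2 := key ⟨u, hu⟩ ⟨w, hw⟩ huw
  have h3 := key ⟨v, hv⟩ ⟨w, hw⟩ hvw
  omega

theorem IsTerminal.exists_pair {G : SimpleGraph V} {W : Set V} {x : V} (h : IsTerminal G W x) :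
    ∃ y ∈ W, ∃ z ∈ W, x ≠ y ∧ x ≠ z ∧ y ≠ z ∧ ¬ G.Adj x y ∧ ¬ G.Adj x z := by
  obtain ⟨hx, y, z, ⟨hxy, hyz, hxz⟩, _, ⟨p, -, hp⟩, -⟩ := h
  refine ⟨y, y.2, z, z.2, fun h => hxy (Subtype.ext h), fun h => hxz (Subtype.ext h),
    fun h => hyz (Subtype.ext h), hp y p.start_mem_support, hp z p.end_mem_support⟩

/-! ### Adjacency in the two abstract witnesses -/

section Dagger

variable {d : ℕ}

theorem daggerGraph_adj_s_c : (daggerGraph d).Adj .s .c := by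
  simp [daggerGraph, DaggerRel]

theorem daggerGraph_not_adj_s_b (i : Fin (d + 2)) : ¬ (daggerGraph d).Adj .s (.b i) := by
  simp [daggerGraph, DaggerRel]

theorem daggerGraph_adj_c_b (i : Fin (d + 2)) :
    (daggerGraph d).Adj .c (.b i) ↔ 1 ≤ i.val ∧ i.val ≤ d := by
  simp [daggerGraph, DaggerRel]

theorem daggerGraph_adj_b_b (i j : Fin (d + 2)) :
    (daggerGraph d).Adj (.b i) (.b j) ↔ i.val + 1 = j.val ∨ j.val + 1 = i.val := by
  simp only [daggerGraph, SimpleGraph.fromRel_adj, DaggerRel, ne_eq, DaggerVertex.b.injEq,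
    Fin.ext_iff]
  omega

theorem ddaggerGraph_adj_s_c₁ : (ddaggerGraph d).Adj .s .c₁ := by
  simp [ddaggerGraph, DDaggerRel]

theorem ddaggerGraph_adj_s_c₂ : (ddaggerGraph d).Adj .s .c₂ := by
  simp [ddaggerGraph, DDaggerRel]

theorem ddaggerGraph_adj_c₁_c₂ : (ddaggerGraph d).Adj .c₁ .c₂ := by
  simp [ddaggerGraph, DDaggerRel]

theorem ddaggerGraph_not_adj_s_b (i : Fin (d + 2)) : ¬ (ddaggerGraph d).Adj .s (.b i) := by
  simp [ddaggerGraph, DDaggerRel]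

theorem ddaggerGraph_adj_c₁_b (i : Fin (d + 2)) :
    (ddaggerGraph d).Adj .c₁ (.b i) ↔ i.val ≤ d := by
  simp [ddaggerGraph, DDaggerRel]

theorem ddaggerGraph_adj_c₂_b (i : Fin (d + 2)) :
    (ddaggerGraph d).Adj .c₂ (.b i) ↔ 1 ≤ i.val := by
  simp [ddaggerGraph, DDaggerRel]

theorem ddaggerGraph_adj_b_b (i j : Fin (d + 2)) :
    (ddaggerGraph d).Adj (.b i) (.b j) ↔ i.val + 1 = j.val ∨ j.val + 1 = i.val := by
  simp only [ddaggerGraph, SimpleGraph.fromRel_adj, DDaggerRel, ne_eq, DDaggerVertex.b.injEq,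
    Fin.ext_iff]
  omega

end Dagger

/-- The shallowness condition, transported to an abstract copy of `G.induce W`. -/
theorem InducesPath.transport {G : SimpleGraph V} {W : Set V} {α : Type*} {H : SimpleGraph α}
    (f : H ≃g G.induce W) {t : α}
    (h : InducesPath G (W \ insert (f t).1 (G.neighborSet (f t).1))) :
    (∀ u v, t ≠ u → ¬ H.Adj t u → t ≠ v → ¬ H.Adj t v → u ≠ v →
      ∃ w, t ≠ w ∧ ¬ H.Adj t w ∧ H.Adj u w) ∧
    (∀ u v w, t ≠ u → ¬ H.Adj t u → t ≠ v → ¬ H.Adj t v → t ≠ w → ¬ H.Adj t w →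
      H.Adj u v → H.Adj u w → ¬ H.Adj v w) := by
  have hadj : ∀ u v, G.Adj (f u).1 (f v).1 ↔ H.Adj u v := fun u v => f.map_adj_iff
  have hne : ∀ u v, u ≠ v → (f u).1 ≠ (f v).1 := fun u v huv he =>
    huv (f.injective (Subtype.ext he))
  have hmem : ∀ u, t ≠ u → ¬ H.Adj t u →
      (f u).1 ∈ W \ insert (f t).1 (G.neighborSet (f t).1) := by
    intro u h1 h2
    refine ⟨(f u).2, ?_⟩
    rintro (he | he)
    · exact hne u t h1.symm he
    · exact h2 ((hadj t u).1 he)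
  constructor
  · intro u v hu hu' hv hv' huv
    obtain ⟨w, ⟨hwW, hw⟩, huw⟩ := h.exists_adj (hmem u hu hu') (hmem v hv hv') (hne u v huv)
    obtain ⟨w', hw'⟩ := f.surjective ⟨w, hwW⟩
    obtain rfl : (f w').1 = w := by rw [hw']
    refine ⟨w', ?_, fun h' => hw (Or.inr ((hadj t w').2 h')), (hadj u w').1 huw⟩
    rintro rfl
    exact hw (Or.inl rfl)
  · intro u v w h1 h1' h2 h2' h3 h3' huv huw hvw
    exact h.not_triangle (hmem u h1 h1') (hmem v h2 h2') (hmem w h3 h3')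
      ((hadj u v).2 huv) ((hadj u w).2 huw) ((hadj v w).2 hvw)

theorem IsTerminal.transport {G : SimpleGraph V} {W : Set V} {α : Type*} {H : SimpleGraph α}
    (f : H ≃g G.induce W) {t : α} (h : IsTerminal G W (f t).1) :
    ∃ y z, t ≠ y ∧ t ≠ z ∧ y ≠ z ∧ ¬ H.Adj t y ∧ ¬ H.Adj t z := by
  obtain ⟨y, hy, z, hz, h1, h2, h3, h4, h5⟩ := h.exists_pair
  obtain ⟨y', hy'⟩ := f.surjective ⟨y, hy⟩
  obtain ⟨z', hz'⟩ := f.surjective ⟨z, hz⟩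
  obtain rfl : (f y').1 = y := by rw [hy']
  obtain rfl : (f z').1 = z := by rw [hz']
  refine ⟨y', z', ?_, ?_, ?_, fun h' => h4 (f.map_adj_iff.2 h'), fun h' => h5 (f.map_adj_iff.2 h')⟩
  · rintro rfl; exact h1 rfl
  · rintro rfl; exact h2 rfl
  · rintro rfl; exact h3 rfl

/-- Deleting `N[c]` isolates `b 0` from `b (d + 1)`, and deleting the closed neighborhood of a base
vertex isolates `s`. Deleting that of `b 0` or `b (d + 1)` leaves a triangle of `c` and two
consecutive base vertices; this is where `d ≥ 3` is needed. -/
theorem eq_s_of_isShallow_dagger {G : SimpleGraph V} {W : Set V} {d : ℕ} (hd : 3 ≤ d)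
    (f : daggerGraph d ≃g G.induce W) {t : DaggerVertex d}
    (hp : InducesPath G (W \ insert (f t).1 (G.neighborSet (f t).1))) : t = .s := by
  obtain ⟨hconn, htri⟩ := hp.transport f
  cases t with
  | s => rfl
  | c =>
    exfalso
    obtain ⟨w, hw1, hw2, hw3⟩ := hconn (.b ⟨0, by omega⟩) (.b ⟨d + 1, by omega⟩) (by simp)
      (by simp [daggerGraph_adj_c_b]) (by simp) (by simp [daggerGraph_adj_c_b]) (by simp)
    cases w with
    | s => exact hw2 daggerGraph_adj_s_c.symm
    | c => exact hw1 rfl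
    | b i =>
      rw [daggerGraph_adj_c_b] at hw2
      rw [daggerGraph_adj_b_b] at hw3
      simp at hw3
      omega
  | b i =>
    exfalso
    have hne : ∀ j : Fin (d + 2), i.val ≠ j.val → (DaggerVertex.b i) ≠ .b j := by
      intro j hij he
      simp only [DaggerVertex.b.injEq] at he
      exact hij (by rw [he])
    by_cases hi : 1 ≤ i.val ∧ i.val ≤ d
    · have hc := ((daggerGraph_adj_c_b i).2 hi).symm
      obtain ⟨k, hk, hki⟩ : ∃ k : Fin (d + 2), (k.val + 1 < i.val ∨ i.val + 1 < k.val) ∧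
          (k.val = 0 ∨ k.val = d + 1) := by
        rcases Nat.lt_or_ge i.val d with h | h
        · exact ⟨⟨d + 1, by omega⟩, Or.inr (by simpa using h), Or.inr rfl⟩
        · exact ⟨⟨0, by omega⟩, Or.inl (by simp; omega), Or.inl rfl⟩
      obtain ⟨w, hw1, hw2, hw3⟩ := hconn .s (.b k) (by simp)
        (fun h => daggerGraph_not_adj_s_b _ h.symm) (hne k (by omega))
        (by rw [daggerGraph_adj_b_b]; omega) (by simp)
      cases w with
      | s => exact hw3.ne rfl
      | c => exact hw2 hc
      | b j => exact daggerGraph_not_adj_s_b _ hw3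
    · have hci : ¬ (daggerGraph d).Adj (.b i) .c :=
        fun h => hi ((daggerGraph_adj_c_b i).1 h.symm)
      have hi2 := i.isLt
      obtain ⟨k, hk1, hkd, hk⟩ : ∃ k, 1 ≤ k ∧ k + 1 ≤ d ∧
          (k + 2 < i.val ∨ i.val + 1 < k) := by
        rcases Nat.eq_zero_or_pos i.val with h | h
        · exact ⟨2, by omega, by omega, by omega⟩
        · exact ⟨1, by omega, by omega, by omega⟩
      refine htri .c (.b ⟨k, by omega⟩) (.b ⟨k + 1, by omega⟩) (by simp) hci
        (hne _ (by simp; omega)) ?_ (hne _ (by simp; omega)) ?_ ?_ ?_ ?_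
      · rw [daggerGraph_adj_b_b]; simp; omega
      · rw [daggerGraph_adj_b_b]; simp; omega
      · rw [daggerGraph_adj_c_b]; simp; omega
      · rw [daggerGraph_adj_c_b]; simp; omega
      · rw [daggerGraph_adj_b_b]; simp

/-- Deleting `N[c₁]` or `N[c₂]` leaves a single vertex, which is a path, so these cases need
terminality: a terminal has two nonneighbors. The remaining vertices leave `s` isolated, or a
triangle through `c₁` or `c₂`. -/
theorem eq_s_of_isShallow_ddagger {G : SimpleGraph V} {W : Set V} {d : ℕ} (hd : 2 ≤ d)
    (f : ddaggerGraph d ≃g G.induce W) {t : DDaggerVertex d} (ht : IsTerminal G W (f t).1)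
    (hp : InducesPath G (W \ insert (f t).1 (G.neighborSet (f t).1))) : t = .s := by
  obtain ⟨hconn, htri⟩ := hp.transport f
  cases t with
  | s => rfl
  | c₁ =>
    exfalso
    obtain ⟨y, z, h1, h2, h3, h4, h5⟩ := ht.transport f
    have key : ∀ w, DDaggerVertex.c₁ ≠ w → ¬ (ddaggerGraph d).Adj .c₁ w →
        w = .b ⟨d + 1, by omega⟩ := by
      intro w hw1 hw2
      cases w with
      | s => exact absurd ddaggerGraph_adj_s_c₁.symm hw2
      | c₁ => exact absurd rfl hw1
      | c₂ => exact absurd ddaggerGraph_adj_c₁_c₂ hw2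
      | b i =>
        rw [ddaggerGraph_adj_c₁_b] at hw2
        simp only [DDaggerVertex.b.injEq, Fin.ext_iff]
        omega
    exact h3 ((key y h1 h4).trans (key z h2 h5).symm)
  | c₂ =>
    exfalso
    obtain ⟨y, z, h1, h2, h3, h4, h5⟩ := ht.transport f
    have key : ∀ w, DDaggerVertex.c₂ ≠ w → ¬ (ddaggerGraph d).Adj .c₂ w →
        w = .b ⟨0, by omega⟩ := by
      intro w hw1 hw2
      cases w with
      | s => exact absurd ddaggerGraph_adj_s_c₂.symm hw2
      | c₁ => exact absurd ddaggerGraph_adj_c₁_c₂.symm hw2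
      | c₂ => exact absurd rfl hw1
      | b i =>
        rw [ddaggerGraph_adj_c₂_b] at hw2
        simp only [DDaggerVertex.b.injEq, Fin.ext_iff]
        omega
    exact h3 ((key y h1 h4).trans (key z h2 h5).symm)
  | b i =>
    exfalso
    have hi2 := i.isLt
    have hne : ∀ j : Fin (d + 2), i.val ≠ j.val → (DDaggerVertex.b i) ≠ .b j := by
      intro j hij he
      simp only [DDaggerVertex.b.injEq] at he
      exact hij (by rw [he])
    by_cases hi : 1 ≤ i.val ∧ i.val ≤ d
    · have hc₁ := ((ddaggerGraph_adj_c₁_b i).2 hi.2).symm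
      have hc₂ := ((ddaggerGraph_adj_c₂_b i).2 hi.1).symm
      obtain ⟨k, hk⟩ : ∃ k : Fin (d + 2), k.val + 1 < i.val ∨ i.val + 1 < k.val := by
        rcases Nat.lt_or_ge i.val d with h | h
        · exact ⟨⟨d + 1, by omega⟩, Or.inr (by simpa using h)⟩
        · exact ⟨⟨0, by omega⟩, Or.inl (by simp; omega)⟩
      obtain ⟨w, hw1, hw2, hw3⟩ := hconn .s (.b k) (by simp)
        (fun h => ddaggerGraph_not_adj_s_b _ h.symm) (hne k (by omega))
        (by rw [ddaggerGraph_adj_b_b]; omega) (by simp)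
      cases w with
      | s => exact hw3.ne rfl
      | c₁ => exact hw2 hc₁
      | c₂ => exact hw2 hc₂
      | b j => exact ddaggerGraph_not_adj_s_b _ hw3
    · rcases Nat.eq_zero_or_pos i.val with h0 | h0
      · refine htri .c₂ (.b ⟨2, by omega⟩) (.b ⟨3, by omega⟩) (by simp) ?_
          (hne _ (by simp; omega)) ?_ (hne _ (by simp; omega)) ?_ ?_ ?_ ?_
        · intro h
          rw [SimpleGraph.adj_comm, ddaggerGraph_adj_c₂_b] at h
          omega
        · rw [ddaggerGraph_adj_b_b]; simp; omega
        · rw [ddaggerGraph_adj_b_b]; simp; omega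
        · rw [ddaggerGraph_adj_c₂_b]; simp
        · rw [ddaggerGraph_adj_c₂_b]; simp
        · rw [ddaggerGraph_adj_b_b]; simp
      · refine htri .c₁ (.b ⟨0, by omega⟩) (.b ⟨1, by omega⟩) (by simp) ?_
          (hne _ h0.ne') ?_ (hne _ (by simp; omega)) ?_ ?_ ?_ ?_
        · intro h
          rw [SimpleGraph.adj_comm, ddaggerGraph_adj_c₁_b] at h
          omega
        · rw [ddaggerGraph_adj_b_b]; simp; omega
        · rw [ddaggerGraph_adj_b_b]; simp only; omega
        · rw [ddaggerGraph_adj_c₁_b]; simp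
        · rw [ddaggerGraph_adj_c₁_b]; simp; omega
        · rw [ddaggerGraph_adj_b_b]; simp

/-- `Config` indexes the path by `ℕ`, so indices are clamped at `d + 1`; no field looks beyond that.
-/
theorem config_of_dagger {G : SimpleGraph V} {W : Set V} {d : ℕ} (hd : 3 ≤ d)
    (f : daggerGraph d ≃g G.induce W) :
    Config G (f .c).1 (f .c).1 (fun i => (f (.b ⟨min i (d + 1), by omega⟩)).1) d (f .s).1 := by
  have hadj : ∀ u v, G.Adj (f u).1 (f v).1 ↔ (daggerGraph d).Adj u v := fun u v => f.map_adj_iff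
  refine ⟨by omega, ?_, ?_, fun i _ => ?_, fun i _ _ => ?_, fun i _ _ => ?_, ?_, ?_, fun i _ => ?_,
    fun i j _ _ => ?_, fun i j _ _ he => ?_⟩
  · exact (hadj _ _).2 daggerGraph_adj_s_c
  · exact (hadj _ _).2 daggerGraph_adj_s_c
  · rw [hadj]; exact daggerGraph_not_adj_s_b _
  · rw [hadj, daggerGraph_adj_c_b]; simp; omega
  · rw [hadj, daggerGraph_adj_c_b]; simp; omega
  · rw [hadj, daggerGraph_adj_c_b]; simp
  · rw [hadj, daggerGraph_adj_c_b]; simp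
  · rw [hadj, daggerGraph_adj_b_b]; simp only; omega
  · rw [hadj, daggerGraph_adj_b_b]; simp only; omega
  · have := f.injective (Subtype.ext he)
    simp only [DaggerVertex.b.injEq, Fin.mk.injEq] at this
    omega

theorem config_of_ddagger {G : SimpleGraph V} {W : Set V} {d : ℕ} (hd : 2 ≤ d)
    (f : ddaggerGraph d ≃g G.induce W) :
    Config G (f .c₁).1 (f .c₂).1 (fun i => (f (.b ⟨min i (d + 1), by omega⟩)).1) d (f .s).1 := by
  have hadj : ∀ u v, G.Adj (f u).1 (f v).1 ↔ (ddaggerGraph d).Adj u v :=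
    fun u v => f.map_adj_iff
  refine ⟨by omega, ?_, ?_, fun i _ => ?_, fun i _ _ => ?_, fun i _ _ => ?_, ?_, ?_, fun i _ => ?_,
    fun i j _ _ => ?_, fun i j _ _ he => ?_⟩
  · exact (hadj _ _).2 ddaggerGraph_adj_s_c₁
  · exact (hadj _ _).2 ddaggerGraph_adj_s_c₂
  · rw [hadj]; exact ddaggerGraph_not_adj_s_b _
  · rw [hadj, ddaggerGraph_adj_c₁_b]; simp; omega
  · rw [hadj, ddaggerGraph_adj_c₂_b]; simp; omega
  · rw [hadj, ddaggerGraph_adj_c₁_b]; simp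
  · rw [hadj, ddaggerGraph_adj_c₂_b]; simp
  · rw [hadj, ddaggerGraph_adj_b_b]; simp only; omega
  · rw [hadj, ddaggerGraph_adj_b_b]; simp only; omega
  · have := f.injective (Subtype.ext he)
    simp only [DDaggerVertex.b.injEq, Fin.mk.injEq] at this
    omega

/-- A shallow terminal of a witness is the foot of a configuration. -/
theorem IsShallowTerminalOf.exists_config {G : SimpleGraph V} {W : Set V} {s : V}
    (h : IsShallowTerminalOf G W s) : ∃ c₁ c₂ b d, Config G c₁ c₂ b d s := by
  obtain ⟨hW, ht, hp⟩ := h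
  obtain ⟨hsW, -⟩ := id ht
  rcases hW with ⟨d, hd, ⟨f⟩⟩ | ⟨d, hd, ⟨f⟩⟩
  · obtain ⟨t, hft⟩ := f.symm.surjective ⟨s, hsW⟩
    obtain rfl : (f.symm t).1 = s := by rw [hft]
    obtain rfl := eq_s_of_isShallow_dagger hd f.symm hp
    exact ⟨_, _, _, _, config_of_dagger hd f.symm⟩
  · obtain ⟨t, hft⟩ := f.symm.surjective ⟨s, hsW⟩
    obtain rfl : (f.symm t).1 = s := by rw [hft]
    obtain rfl := eq_s_of_isShallow_ddagger hd f.symm ht hp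
    exact ⟨_, _, _, _, config_of_ddagger hd f.symm⟩

end IntervalDeletion

theorem theorem2p1 {V : Type*} [Finite V] (G : SimpleGraph V)
    (hG : IntervalDeletion.IsReduced G) (W : Set V) (s : V)
    (hs : IntervalDeletion.IsShallowTerminalOf G W s) :
    IntervalDeletion.IsSimplicial G s := by
  obtain ⟨c₁, c₂, b, d, h⟩ := hs.exists_config
  exact h.isSimplicial hG
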